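/- Let $k$ be a field, let $f_1,\dots,f_r\in k[x_1,\dots,x_N]$ and $A=k[x_1,\dots,x_N]/(f_1,\dots,f_r)$, and suppose that $A$ is smooth over $k$ and that $\operatorname{Spec}A$ is of pure dimension $n\le N$ (every irreducible component has dimension $n$). Let $\mathrm{ROW}\subset\{1,\dots,r\}$ and $\mathrm{COL}\subset\{1,\dots,N\}$ be increasing $(N-n)$-tuples, let $M=\left(\frac{\partial f_i}{\partial x_j}\right)_{i\in \mathrm{ROW},\,j\in \mathrm{COL}}$ be the corresponding submatrix of the Jacobian matrix, let $h=\det M\in k[x_1,\dots,x_N]$ (with $h=1$ if $M$ is the $0\times 0$ matrix), and let $C=(C_{ij})_{i\in \mathrm{ROW},\,j\in \mathrm{COL}}$ be the cofactor matrix of $M$. For each $j'\in\{1,\dots,N\}\setminus \mathrm{COL}$ put $$D_{j'}:=h\,\frac{\partial}{\partial x_{j'}}-\sum_{i\in \mathrm{ROW},\ j\in \mathrm{COL}}\frac{\partial f_i}{\partial x_{j'}}\,C_{ij}\,\frac{\partial}{\partial x_j}.$$ Let $g_1,\dots,g_m\in k[x_1,\dots,x_N]$ and let $I\subset A$ be the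 ideal generated by their images. For a $k$-algebra $B$ and an ideal $L\subset B$, let $D^{\le 1}_{B/k}(L)\subset B$ be the ideal generated by all $D(b)$ with $b\in L$ and $D\colon B\to B$ a $k$-linear differential operator of order $\le 1$, that is, a map of the form $D(b)=u(1\otimes b)$ for some $B$-linear map $u\colon (B\otimes_k B)/J^{2}\to B$, where $J$ is the kernel of the multiplication map $B\otimes_k B\to B$ and $B$ acts on the left factor. Then the extension to $A[h^{-1}]$ of the ideal $$(g_1,\dots,g_m)+\big(D_{j'}(g_1),\dots,D_{j'}(g_m)\big)_{j'\notin \mathrm{COL}}\subset k[x_1,\dots,x_N]$$ is equal to $D^{\le 1}_{A[h^{-1}]/k}\big(I\,A[h^{-1}]\big)$. -/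

import Mathlib

open scoped TensorProduct

namespace DiffGen

/-! ### Differential operators and derivatives of ideals -/

section DifferentialOperators

variable (k A : Type*) [CommRing k] [CommRing A] [Algebra k A]

/-- The algebra of principal parts `P^n_{A/k} = (A ⊗[k] A) / J ^ (n + 1)`, where `J` is the kernel
of the multiplication `A ⊗[k] A → A`. It is an `A`-algebra through the left tensor factor. -/
abbrev PrincipalParts (n : ℕ) : Type _ :=
  (A ⊗[k] A) ⧸ (KaehlerDifferential.ideal k A) ^ (n + 1)

variable {k A}

/-- A `k`-linear map `D : A → A` is a differential operator of order `≤ n` if it factors as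
`a ↦ u (1 ⊗ a)` for some `A`-linear map `u : P^n_{A/k} → A`. -/
def IsDifferentialOperator (n : ℕ) (D : A →ₗ[k] A) : Prop :=
  ∃ u : PrincipalParts k A n →ₗ[A] A,
    ∀ a : A, D a = u (Ideal.Quotient.mk ((KaehlerDifferential.ideal k A) ^ (n + 1)) (1 ⊗ₜ[k] a))

variable (k)

/-- `D^{≤ n}_{A/k} I`: the ideal of `A` generated by all `D a`, where `a ∈ I` and `D` is a
differential operator of order `≤ n` on `A` over `k`. -/
def derivativeIdeal (n : ℕ) (I : Ideal A) : Ideal A :=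
  Ideal.span {b | ∃ D : A →ₗ[k] A, IsDifferentialOperator n D ∧ ∃ a ∈ I, D a = b}

end DifferentialOperators

/-- `Spec A` is of pure dimension `n`: every irreducible component of `Spec A`, that is
`Spec (A ⧸ p)` for a minimal prime `p`, has Krull dimension `n`. -/
def IsPureDimension (A : Type*) [CommRing A] (n : ℕ) : Prop :=
  ∀ p ∈ minimalPrimes A, ringKrullDim (A ⧸ p) = n

/-! ### Jacobian data -/

section Jacobian

variable {k : Type*} [Field k] {N r c : ℕ}

/-- The coordinate ring `k[x_1, …, x_N] / (f_1, …, f_r)`. -/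
abbrev CoordRing (f : Fin r → MvPolynomial (Fin N) k) : Type _ :=
  MvPolynomial (Fin N) k ⧸ Ideal.span (Set.range f)

/-- The Jacobian matrix `(∂ f_i / ∂ x_j)`, with polynomial entries. -/
noncomputable def jacobian (f : Fin r → MvPolynomial (Fin N) k) :
    Matrix (Fin r) (Fin N) (MvPolynomial (Fin N) k) :=
  Matrix.of fun i j => MvPolynomial.pderiv j (f i)

/-- The square submatrix of the Jacobian with rows `ROW` and columns `COL`. -/
noncomputable def minorMatrix (f : Fin r → MvPolynomial (Fin N) k)
    (ROW : Fin c ↪o Fin r) (COL : Fin c ↪o Fin N) :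
    Matrix (Fin c) (Fin c) (MvPolynomial (Fin N) k) :=
  (jacobian f).submatrix ROW COL

/-- The determinant `h` of the submatrix of the Jacobian (it is `1` for the `0 × 0` matrix). -/
noncomputable def minorDet (f : Fin r → MvPolynomial (Fin N) k)
    (ROW : Fin c ↪o Fin r) (COL : Fin c ↪o Fin N) : MvPolynomial (Fin N) k :=
  (minorMatrix f ROW COL).det

/-- The cofactor matrix of the submatrix of the Jacobian, the transpose of its adjugate. -/
noncomputable def cofactorMatrix (f : Fin r → MvPolynomial (Fin N) k)
    (ROW : Fin c ↪o Fin r) (COL : Fin c ↪o Fin N) :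
    Matrix (Fin c) (Fin c) (MvPolynomial (Fin N) k) :=
  (minorMatrix f ROW COL).adjugate.transpose

/-- The derivation
`D_{j'} = h ∂/∂x_{j'} - ∑_{i ∈ ROW, j ∈ COL} (∂ f_i / ∂ x_{j'}) C_{ij} ∂/∂x_j`
of `k[x_1, …, x_N]`. -/
noncomputable def jacobianDerivation (f : Fin r → MvPolynomial (Fin N) k)
    (ROW : Fin c ↪o Fin r) (COL : Fin c ↪o Fin N) (j' : Fin N) :
    Derivation k (MvPolynomial (Fin N) k) (MvPolynomial (Fin N) k) :=
  minorDet f ROW COL • MvPolynomial.pderiv j' -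
    ∑ i : Fin c, ∑ j : Fin c,
      (jacobian f (ROW i) j' * cofactorMatrix f ROW COL i j) • MvPolynomial.pderiv (COL j)

/-- The ring `A[h⁻¹]`, where `A = k[x_1, …, x_N] / (f_1, …, f_r)` and `h` is the minor of the
Jacobian on the rows `ROW` and columns `COL`. -/
abbrev LocalizedRing (f : Fin r → MvPolynomial (Fin N) k)
    (ROW : Fin c ↪o Fin r) (COL : Fin c ↪o Fin N) : Type _ :=
  Localization.Away (Ideal.Quotient.mk (Ideal.span (Set.range f)) (minorDet f ROW COL))

/-- The ideal `(g_1, …, g_m) + (D_{j'}(g_1), …, D_{j'}(g_m))_{j' ∉ COL}` of `k[x_1, …, x_N]`. -/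
noncomputable def generatedIdeal {m : ℕ} (f : Fin r → MvPolynomial (Fin N) k)
    (ROW : Fin c ↪o Fin r) (COL : Fin c ↪o Fin N) (g : Fin m → MvPolynomial (Fin N) k) :
    Ideal (MvPolynomial (Fin N) k) :=
  Ideal.span (Set.range g) ⊔
    Ideal.span {p | ∃ j' : Fin N, j' ∉ Set.range COL ∧ ∃ i : Fin m,
      p = jacobianDerivation f ROW COL j' (g i)}

end Jacobian

end DiffGen

namespace DiffGen

/-! ### Differential operators of order at most one -/

section FirstOrder

variable {k A : Type*} [CommRing k] [CommRing A] [Algebra k A]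

/-! Write `C` for $A[h^{-1}]$. An operator of order at most one on `C` is a multiplication plus a
derivation, so everything rests on describing $\mathrm{Der}_k(C)$. Differentiating $f_i=0$ and
inverting `h` (Cramer's rule) shows that the $n$ differentials $dx_l$, $l\notin\mathrm{COL}$, span
$\Omega_{C/k}$. They are also independent. Over the fraction field of `C ⧸ q`, `q` a minimal prime,
$n$ spanning differentials cannot be dependent, since the transcendence degree is at least $n$.
Hence the coefficients of a relation over `C` are nilpotent, and projectivity of $\Omega_{C/k}$
(smoothness) with Nakayama makes them zero. The basis $dx_l$ has dual derivations $d_l$, which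
generate $\mathrm{Der}_k(C)$, and $D_l$ induces $h\,d_l$ with `h` a unit. By the Leibniz rule it
suffices to apply the $d_l$ to generators of the ideal. -/

theorem isDifferentialOperator_one_of_derivation (E : Derivation k A A) (c : A) :
    IsDifferentialOperator 1 (c • LinearMap.id + (E : A →ₗ[k] A)) := by
  let mul : A ⊗[k] A →ₗ[A] A := (Algebra.TensorProduct.lmul'' k (S := A)).toLinearMap
  let w : A ⊗[k] A →ₗ[A] A := c • mul + E.tensorProductTo
  have hmul : ∀ x, mul x = Algebra.TensorProduct.lmul' (S := A) k x := fun _ => rfl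
  -- `E.tensorProductTo` obeys a Leibniz rule along `mul`, so both summands of `w` kill a product of
  -- two elements of `ker mul`.
  have hw : (KaehlerDifferential.ideal k A ^ (1 + 1)).restrictScalars A ≤ LinearMap.ker w := by
    intro x hx
    rw [Submodule.restrictScalars_mem, one_add_one_eq_two, pow_two] at hx
    rw [LinearMap.mem_ker]
    induction hx using Submodule.mul_induction_on' with
    | mem_mul_mem x hx y hy =>
      rw [RingHom.mem_ker] at hx hy
      simp [w, hmul, Derivation.tensorProductTo_mul, hx, hy]
    | add x _ y _ hx hy => rw [map_add, hx, hy, add_zero]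
  refine ⟨(((KaehlerDifferential.ideal k A ^ (1 + 1)).restrictScalars A).liftQ w hw).comp
    (Submodule.Quotient.restrictScalarsEquiv A _).symm.toLinearMap, fun a => ?_⟩
  change c • a + E a = w (1 ⊗ₜ a)
  simp [w, hmul, Derivation.tensorProductTo_tmul]

theorem IsDifferentialOperator.exists_derivation {D : A →ₗ[k] A}
    (hD : IsDifferentialOperator 1 D) :
    ∃ E : Derivation k A A, ∀ a, D a = D 1 * a + E a := by
  obtain ⟨u, hu⟩ := hD
  -- Apply `u` to $(1\otimes a-a\otimes1)(1\otimes b-b\otimes1)\in J^2$; the result is the Leibniz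
  -- rule for `D - D 1`.
  have key : ∀ a b, D (a * b) - a * D b - b * D a + a * b * D 1 = 0 := by
    intro a b
    have h0 : Ideal.Quotient.mk (KaehlerDifferential.ideal k A ^ (1 + 1))
        (((1 : A) ⊗ₜ[k] a - a ⊗ₜ 1) * ((1 : A) ⊗ₜ[k] b - b ⊗ₜ 1)) = 0 := by
      rw [Ideal.Quotient.eq_zero_iff_mem, one_add_one_eq_two, pow_two]
      exact Ideal.mul_mem_mul (KaehlerDifferential.one_smul_sub_smul_one_mem_ideal k a)
        (KaehlerDifferential.one_smul_sub_smul_one_mem_ideal k b)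
    have h1 : ((1 : A) ⊗ₜ[k] a - a ⊗ₜ 1) * ((1 : A) ⊗ₜ[k] b - b ⊗ₜ 1) =
        (1 : A) ⊗ₜ[k] (a * b) - a • ((1 : A) ⊗ₜ[k] b) - b • ((1 : A) ⊗ₜ[k] a)
          + (a * b) • ((1 : A) ⊗ₜ[k] (1 : A)) := by
      simp only [sub_mul, mul_sub, Algebra.TensorProduct.tmul_mul_tmul, one_mul, mul_one,
        TensorProduct.smul_tmul', smul_eq_mul]
      abel
    rw [h1] at h0
    have hs : ∀ (c : A) (x : A ⊗[k] A), Ideal.Quotient.mk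
        (KaehlerDifferential.ideal k A ^ (1 + 1)) (c • x) =
        c • Ideal.Quotient.mk (KaehlerDifferential.ideal k A ^ (1 + 1)) x := fun _ _ => rfl
    have h2 := congrArg u h0
    rw [map_add, map_sub, map_sub, hs, hs, hs, map_add, map_sub, map_sub, map_smul, map_smul,
      map_smul, map_zero, ← hu, ← hu, ← hu, ← hu] at h2
    simpa only [smul_eq_mul] using h2
  refine ⟨Derivation.mk' (D - D 1 • LinearMap.id) fun a b => ?_, fun a => ?_⟩
  · simp only [LinearMap.sub_apply, LinearMap.smul_apply, LinearMap.id_apply, smul_eq_mul]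
    linear_combination key a b
  · simp

end FirstOrder

/-! ### Krull dimension and differentials -/

section Dimension

theorem ringKrullDim_le_of_isIntegral {R S : Type*} [CommRing R] [CommRing S] [Algebra R S]
    [Algebra.IsIntegral R S] : ringKrullDim S ≤ ringKrullDim R :=
  Order.krullDim_le_of_strictMono (PrimeSpectrum.comap (algebraMap R S))
    fun _ _ h => Ideal.IsIntegral.comap_lt_comap (R := R) h

universe u

variable {k : Type u} [Field k]

open scoped IntermediateField.algebraAdjoinAdjoin in
-- Over `E = k(x)` all the $dx_i$ die, so `L` is unramified, hence algebraic, over `E`.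
theorem trdeg_le_of_span_kaehlerDifferential_eq_top {L : Type u} [Field L] [Algebra k L]
    [Algebra.EssFiniteType k L] {ι : Type*} [Fintype ι] (x : ι → L)
    (hx : Submodule.span L (Set.range fun i => KaehlerDifferential.D k L (x i)) = ⊤) :
    Algebra.trdeg k L ≤ Fintype.card ι := by
  let E := IntermediateField.adjoin k (Set.range x)
  have hsub : Subsingleton (Ω[L⁄E]) := by
    refine subsingleton_of_forall_eq 0 fun ω => ?_
    obtain ⟨η, rfl⟩ := KaehlerDifferential.map_surjective k E L ω
    have hη : η ∈ Submodule.span L (Set.range fun i => KaehlerDifferential.D k L (x i)) :=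
      hx ▸ Submodule.mem_top
    induction hη using Submodule.span_induction with
    | mem _ h =>
      obtain ⟨i, rfl⟩ := h
      have hi : x i ∈ E := IntermediateField.subset_adjoin k _ ⟨i, rfl⟩
      simpa using (KaehlerDifferential.D E L).map_algebraMap ⟨x i, hi⟩
    | zero => simp
    | add _ _ _ _ h h' => rw [map_add, h, h', add_zero]
    | smul _ _ _ h => rw [map_smul, h, smul_zero]
  have : Algebra.FormallyUnramified E L := ⟨hsub⟩
  have : Algebra.EssFiniteType E L := Algebra.EssFiniteType.of_comp k E L
  have : Algebra.IsSeparable E L := Algebra.FormallyUnramified.isSeparable E L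
  have : Algebra.IsAlgebraic (Algebra.adjoin k (Set.range x)) L :=
    (IsFractionRing.comap_isAlgebraic_iff (K := E)).mpr inferInstance
  refine (Algebra.IsAlgebraic.trdeg_le_cardinalMk k (Set.range x)).trans ?_
  have := Cardinal.mk_range_le_lift (f := x)
  simpa using this

theorem ringKrullDim_le_of_span_kaehlerDifferential_eq_top {R L : Type u} [CommRing R]
    [Algebra k R] [Algebra.FiniteType k R] [Field L] [Algebra k L]
    [Algebra.EssFiniteType k L] (φ : R →ₐ[k] L) (hφ : Function.Injective φ)
    {ι : Type*} [Fintype ι] (x : ι → L)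
    (hx : Submodule.span L (Set.range fun i => KaehlerDifferential.D k L (x i)) = ⊤) :
    ringKrullDim R ≤ Fintype.card ι := by
  have : Nontrivial R := φ.toRingHom.domain_nontrivial
  -- Noether normalization: `s` bounds the dimension of `R`, and its `s` independent variables embed
  -- in `L`.
  obtain ⟨s, g, hg, hint⟩ := exists_integral_inj_algHom_of_fg k R
  algebraize [g.toRingHom]
  have h1 : ringKrullDim R ≤ s := by
    refine (ringKrullDim_le_of_isIntegral (R := MvPolynomial (Fin s) k)).trans ?_
    rw [MvPolynomial.ringKrullDim_of_isNoetherianRing]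
    simp
  have h2 : AlgebraicIndependent k fun i => (φ.comp g) (MvPolynomial.X i) := by
    have := (MvPolynomial.algebraicIndependent_X (Fin s) k).map' (f := φ.comp g) (hφ.comp hg)
    exact this
  have h3 : s ≤ Fintype.card ι := by
    have := h2.lift_cardinalMk_le_trdeg.trans
      (Cardinal.lift_le.mpr (trdeg_le_of_span_kaehlerDifferential_eq_top x hx))
    simpa using this
  exact h1.trans (by exact_mod_cast h3)

end Dimension

/-! ### From nilpotent relations to independence; the quotient rule -/

section Independence

theorem linearIndependent_of_isNilpotent_of_projective {C M ι : Type*} [CommRing C]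
    [AddCommGroup M] [Module C M] [Module.Projective C M] [Finite ι] (v : ι → M)
    (hv : Submodule.span C (Set.range v) = ⊤)
    (h : ∀ c : ι →₀ C, Finsupp.linearCombination C v c = 0 → ∀ i, IsNilpotent (c i)) :
    LinearIndependent C v := by
  let π := Finsupp.linearCombination C v
  have hπ : Function.Surjective π := by
    rw [← LinearMap.range_eq_top, Finsupp.range_linearCombination, hv]
  obtain ⟨σ, hσ⟩ := Module.projective_lifting_property π LinearMap.id hπ
  -- The projection onto `ker π`, which makes the kernel finitely generated and puts it inside
  -- `nilradical C • ker π`.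
  let e : (ι →₀ C) →ₗ[C] (ι →₀ C) := LinearMap.id - σ.comp π
  have hσ' : ∀ m, π (σ m) = m := fun m => LinearMap.congr_fun hσ m
  have he : ∀ x, e x ∈ LinearMap.ker π := fun x => by simp [e, hσ']
  have he' : ∀ x ∈ LinearMap.ker π, e x = x := fun x hx => by
    rw [LinearMap.mem_ker] at hx
    simp [e, hx]
  have hK : LinearMap.ker π = (⊤ : Submodule C (ι →₀ C)).map e := by
    apply le_antisymm
    · exact fun x hx => ⟨x, trivial, he' x hx⟩
    · rintro _ ⟨x, -, rfl⟩
      exact he x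
  have hfg : (LinearMap.ker π).FG := hK ▸ Module.Finite.fg_top.map e
  rw [linearIndependent_iff_ker]
  refine Submodule.eq_bot_of_le_smul_of_le_jacobson_bot (nilradical C) _ hfg (fun x hx => ?_)
    (Ideal.radical_le_jacobson)
  rw [← he' x hx, ← x.sum_single, map_finsuppSum]
  refine Submodule.sum_mem _ fun i _ => ?_
  have : e (Finsupp.single i (x i)) = x i • e (Finsupp.single i 1) := by
    rw [← map_smul, Finsupp.smul_single, smul_eq_mul, mul_one]
  change e (Finsupp.single i (x i)) ∈ _
  rw [this]
  exact Submodule.smul_mem_smul (h x hx i) (he _)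

variable {k C M : Type*} [CommRing k] [CommRing C] [Algebra k C] [AddCommGroup M] [Module k M]
  [Module C M]

/-- The quotient rule, for passing to `A[h⁻¹]` and to fraction fields. -/
theorem derivation_mem_of_isUnit_mul_eq (E : Derivation k C M) {S : Submodule C M} {u c a : C}
    (hu : IsUnit u) (h : u * c = a) (hSu : E u ∈ S) (hSa : E a ∈ S) : E c ∈ S := by
  have h1 := congrArg E h
  rw [E.leibniz] at h1
  refine (Submodule.smul_mem_iff_of_isUnit S hu).mp ?_
  rw [eq_sub_of_add_eq h1]
  exact S.sub_mem hSa (S.smul_mem _ hSu)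

end Independence

/-! ### Derivations and the Jacobian -/

section JacobianDerivations

variable {k : Type*} [Field k] {N r c : ℕ}

theorem sum_eq_sum_range_add_sum_compl {M : Type*} [AddCommMonoid M] (COL : Fin c ↪o Fin N)
    [Fintype {l // l ∉ Set.range COL}] (F : Fin N → M) :
    ∑ l, F l = ∑ j, F (COL j) + ∑ l : {l // l ∉ Set.range COL}, F l := by
  classical
  have h := Equiv.sum_comp (Equiv.ofInjective COL COL.injective)
    fun l : {l // l ∈ Set.range COL} => F l
  rw [← Fintype.sum_subtype_add_sum_subtype (· ∈ Set.range COL) F]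
  refine congrArg₂ (· + ·) (Eq.trans ?_ h.symm) ?_ <;> congr!

variable {C M : Type*} [CommRing C] [Algebra k C] [AddCommGroup M] [Module k M] [Module C M]
  (φ : MvPolynomial (Fin N) k →ₐ[k] C) (E : Derivation k C M)

theorem derivation_apply_algHom (p : MvPolynomial (Fin N) k) :
    E (φ p) = ∑ l, φ (MvPolynomial.pderiv l p) • E (φ (MvPolynomial.X l)) := by
  induction p using MvPolynomial.induction_on with
  | C a =>
    have h : φ (MvPolynomial.C a) = algebraMap k C a := φ.commutes a
    simp [h]
  | add p q hp hq => simp only [map_add, hp, hq, add_smul, Finset.sum_add_distrib]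
  | mul_X p n hp =>
    rw [map_mul, E.leibniz, hp, Finset.smul_sum]
    simp only [Derivation.leibniz, smul_eq_mul, map_add, map_mul, add_smul, mul_smul,
      Finset.sum_add_distrib]
    congr 1
    rw [Finset.sum_eq_single n]
    · simp
    · intro l _ hl
      simp [MvPolynomial.pderiv_X_of_ne hl.symm]
    · simp

variable {φ} {f : Fin r → MvPolynomial (Fin N) k} (hf : ∀ i, φ (f i) = 0)
  (ROW : Fin c ↪o Fin r) (COL : Fin c ↪o Fin N) [Fintype {l // l ∉ Set.range COL}]

include hf in
-- Cramer's rule: apply `E` to $f_i=0$ for $i\in\mathrm{ROW}$ and multiply the linear system by the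
-- adjugate.
theorem minorDet_smul_derivation_apply (j : Fin c) :
    φ (minorDet f ROW COL) • E (φ (MvPolynomial.X (COL j))) =
      -∑ i, φ (cofactorMatrix f ROW COL i j) • ∑ l : {l // l ∉ Set.range COL},
        φ (jacobian f (ROW i) l) • E (φ (MvPolynomial.X l)) := by
  have h0 : ∀ i, ∑ l : {l // l ∉ Set.range COL},
      φ (jacobian f (ROW i) l) • E (φ (MvPolynomial.X l)) =
        -∑ j', φ (minorMatrix f ROW COL i j') • E (φ (MvPolynomial.X (COL j'))) := by
    intro i
    have h := derivation_apply_algHom φ E (f (ROW i))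
    rw [hf, map_zero, sum_eq_sum_range_add_sum_compl COL] at h
    exact eq_neg_of_add_eq_zero_right h.symm
  have h1 : ∀ j', ∑ i, φ (cofactorMatrix f ROW COL i j) * φ (minorMatrix f ROW COL i j') =
      if j = j' then φ (minorDet f ROW COL) else 0 := by
    intro j'
    have h := congrFun (congrFun (Matrix.adjugate_mul (minorMatrix f ROW COL)) j) j'
    rw [Matrix.mul_apply, Matrix.smul_apply, Matrix.one_apply] at h
    simp only [← map_mul, ← map_sum]
    refine (congrArg φ h).trans ?_
    split_ifs <;> simp [minorDet]
  simp only [h0, smul_neg, Finset.sum_neg_distrib, neg_neg, Finset.smul_sum, smul_smul]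
  rw [Finset.sum_comm]
  simp only [← Finset.sum_smul, h1]
  simp

include hf in
theorem algHom_jacobianDerivation (j' : {l // l ∉ Set.range COL}) (E : Derivation k C C)
    (hE : ∀ l : {l // l ∉ Set.range COL}, E (φ (MvPolynomial.X l)) = if l = j' then 1 else 0)
    (p : MvPolynomial (Fin N) k) :
    φ (jacobianDerivation f ROW COL j' p) = φ (minorDet f ROW COL) * E (φ p) := by
  have h1 : ∀ j, φ (minorDet f ROW COL) * E (φ (MvPolynomial.X (COL j))) =
      -∑ i, φ (jacobian f (ROW i) j' * cofactorMatrix f ROW COL i j) := by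
    intro j
    rw [← smul_eq_mul, minorDet_smul_derivation_apply E hf ROW COL j]
    simp [hE, mul_comm]
  rw [derivation_apply_algHom φ E p, sum_eq_sum_range_add_sum_compl COL, mul_add, Finset.mul_sum]
  simp only [smul_eq_mul, mul_left_comm _ (φ _) (E _), h1, hE]
  simp only [mul_ite, mul_one, mul_zero, Finset.sum_ite_eq', Finset.mem_univ, if_true]
  rw [jacobianDerivation, Derivation.sub_apply, Derivation.smul_apply, map_sub, smul_eq_mul,
    map_mul, add_comm, sub_eq_add_neg]
  simp only [← Derivation.coeFnAddMonoidHom_apply, map_sum, Finset.sum_apply]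
  simp only [Derivation.coeFnAddMonoidHom_apply, Derivation.smul_apply, smul_eq_mul,
    map_mul]
  rw [Finset.sum_comm]
  congr 1
  rw [← Finset.sum_neg_distrib]
  exact Finset.sum_congr rfl fun j _ => by rw [mul_comm, neg_mul, Finset.sum_mul]

variable {ROW COL}

include hf in
theorem span_kaehlerDifferential_eq_top (hh : IsUnit (φ (minorDet f ROW COL)))
    (hφ : ∀ b : C, ∃ u p, IsUnit (φ u) ∧ φ u * b = φ p) :
    Submodule.span C (Set.range fun l : {l // l ∉ Set.range COL} =>
      KaehlerDifferential.D k C (φ (MvPolynomial.X l))) = ⊤ := by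
  set S := Submodule.span C (Set.range fun l : {l // l ∉ Set.range COL} =>
      KaehlerDifferential.D k C (φ (MvPolynomial.X l)))
  have hl : ∀ l : {l // l ∉ Set.range COL},
      KaehlerDifferential.D k C (φ (MvPolynomial.X l)) ∈ S :=
    fun l => Submodule.subset_span ⟨l, rfl⟩
  have hj : ∀ j, KaehlerDifferential.D k C (φ (MvPolynomial.X (COL j))) ∈ S := by
    intro j
    rw [← Submodule.smul_mem_iff_of_isUnit S hh, minorDet_smul_derivation_apply _ hf]
    exact S.neg_mem (S.sum_mem fun i _ => S.smul_mem _ (S.sum_mem fun l _ => S.smul_mem _ (hl l)))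
  have hp : ∀ p, KaehlerDifferential.D k C (φ p) ∈ S := by
    intro p
    rw [derivation_apply_algHom, sum_eq_sum_range_add_sum_compl COL]
    exact S.add_mem (S.sum_mem fun j _ => S.smul_mem _ (hj j))
      (S.sum_mem fun l _ => S.smul_mem _ (hl l))
  rw [eq_top_iff, ← KaehlerDifferential.span_range_derivation, Submodule.span_le]
  rintro _ ⟨b, rfl⟩
  obtain ⟨u, p, hu, h⟩ := hφ b
  exact derivation_mem_of_isUnit_mul_eq _ hu h (hp u) (hp p)

end JacobianDerivations

/-! ### Independence of the spanning differentials -/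

section Smooth

universe u

/-- The auxiliary `R` lets the dimension be known on a subring of `C ⧸ q`, so the dimension of the
localization is never computed. -/
theorem linearIndependent_kaehlerDifferential {k C : Type u} [Field k] [CommRing C] [Algebra k C]
    [Algebra.FiniteType k C] [Module.Projective C (Ω[C⁄k])] {ι : Type*} [Fintype ι] (x : ι → C)
    (hx : Submodule.span C (Set.range fun i => KaehlerDifferential.D k C (x i)) = ⊤)
    (hdim : ∀ q : Ideal C, q ∈ minimalPrimes C → ∃ (R : Type u) (_ : CommRing R) (_ : Algebra k R)
      (_ : Algebra.FiniteType k R) (φ : R →ₐ[k] C ⧸ q), Function.Injective φ ∧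
        ringKrullDim R = Fintype.card ι) :
    LinearIndependent C fun i => KaehlerDifferential.D k C (x i) := by
  refine linearIndependent_of_isNilpotent_of_projective _ hx fun c hc i => ?_
  rw [← mem_nilradical, nilradical, ← Ideal.sInf_minimalPrimes, Submodule.mem_sInf]
  intro (q : Ideal C) hq
  have : q.IsPrime := Ideal.IsMinimalPrime.isPrime hq
  obtain ⟨R, _, _, _, φ, hφ, hR⟩ := hdim q hq
  let L := FractionRing (C ⧸ q)
  let y : ι → L := fun i => algebraMap C L (x i)
  have hy : Submodule.span L (Set.range fun i => KaehlerDifferential.D k L (y i)) = ⊤ := by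
    set S := Submodule.span L (Set.range fun i => KaehlerDifferential.D k L (y i))
    have hC : ∀ b : C, KaehlerDifferential.D k L (algebraMap C L b) ∈ S := by
      intro b
      rw [← KaehlerDifferential.map_D k k C L]
      have hb : KaehlerDifferential.D k C b ∈
          Submodule.span C (Set.range fun i => KaehlerDifferential.D k C (x i)) :=
        hx ▸ Submodule.mem_top
      generalize KaehlerDifferential.D k C b = ω at hb
      induction hb using Submodule.span_induction with
      | mem _ h =>
        obtain ⟨i, rfl⟩ := h
        rw [KaehlerDifferential.map_D]
        exact Submodule.subset_span ⟨i, rfl⟩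
      | zero => simp
      | add _ _ _ _ h h' => rw [map_add]; exact S.add_mem h h'
      | smul a _ _ h =>
        rw [map_smul, ← algebraMap_smul L a]
        exact S.smul_mem _ h
    rw [eq_top_iff, ← KaehlerDifferential.span_range_derivation, Submodule.span_le]
    rintro _ ⟨b, rfl⟩
    obtain ⟨a, s, hs, rfl⟩ := IsFractionRing.div_surjective (A := C ⧸ q) b
    obtain ⟨a, rfl⟩ := Ideal.Quotient.mk_surjective a
    obtain ⟨s, rfl⟩ := Ideal.Quotient.mk_surjective s
    have hs0 : algebraMap (C ⧸ q) L (Ideal.Quotient.mk q s) ≠ 0 := by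
      simpa using nonZeroDivisors.ne_zero hs
    exact derivation_mem_of_isUnit_mul_eq _ (IsUnit.mk0 _ hs0) (mul_div_cancel₀ _ hs0)
      (hC s) (hC a)
  have hli : LinearIndependent L fun i => KaehlerDifferential.D k L (y i) := by
    obtain ⟨κ, a, ha, hspan, hind⟩ :=
      exists_linearIndependent' L fun i => KaehlerDifferential.D k L (y i)
    have : Finite κ := Finite.of_injective a ha
    have := Fintype.ofFinite κ
    rw [hy] at hspan
    have hle := ringKrullDim_le_of_span_kaehlerDifferential_eq_top
      ((IsScalarTower.toAlgHom k (C ⧸ q) L).comp φ)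
      ((IsFractionRing.injective (C ⧸ q) L).comp hφ) (fun i => y (a i)) hspan
    rw [hR] at hle
    -- An independent subfamily that still spans must, by the dimension bound, have as many members
    -- as the whole family.
    have hcard : Fintype.card ι = Fintype.card κ :=
      le_antisymm (by exact_mod_cast hle) (Fintype.card_le_of_injective a ha)
    refine linearIndependent_of_top_le_span_of_card_eq_finrank hy.ge ?_
    rw [hcard, ← Module.finrank_eq_card_basis (Module.Basis.mk hind hspan.ge)]
  have h0 : ∑ i, algebraMap C L (c i) • KaehlerDifferential.D k L (y i) = 0 := by
    have := congrArg (KaehlerDifferential.map k k C L) hc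
    rw [Finsupp.linearCombination_apply, Finsupp.sum_fintype _ _ (by simp), map_sum, map_zero]
      at this
    simpa only [map_smul, KaehlerDifferential.map_D, algebraMap_smul] using this
  have h1 := Fintype.linearIndependent_iff.mp hli _ h0 i
  rw [IsScalarTower.algebraMap_apply C (C ⧸ q) L] at h1
  exact Ideal.Quotient.eq_zero_iff_mem.mp
    ((IsFractionRing.injective (C ⧸ q) L) (h1.trans (map_zero _).symm))

end Smooth

/-! ### Derivative ideals from a dual basis of derivations -/

section DerivativeIdeal

variable {k C ι : Type*} [CommRing k] [CommRing C] [Algebra k C] [Fintype ι]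

theorem exists_dual_derivations [DecidableEq ι] (x : ι → C)
    (hli : LinearIndependent C fun i => KaehlerDifferential.D k C (x i))
    (hx : Submodule.span C (Set.range fun i => KaehlerDifferential.D k C (x i)) = ⊤) :
    ∃ d : ι → Derivation k C C, (∀ l i, d l (x i) = if i = l then 1 else 0) ∧
      ∀ (E : Derivation k C C) (a : C), E a = ∑ l, E (x l) * d l a := by
  let b := Module.Basis.mk hli hx.ge
  have hb : ∀ i, b i = KaehlerDifferential.D k C (x i) := fun i => by simp [b]
  refine ⟨fun l => (b.coord l).compDer (KaehlerDifferential.D k C), fun l i => ?_, fun E a => ?_⟩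
  · change b.coord l (KaehlerDifferential.D k C (x i)) = _
    rw [← hb]
    simp [Finsupp.single_apply]
  · rw [← E.liftKaehlerDifferential_comp_D a, ← b.sum_repr (KaehlerDifferential.D k C a), map_sum]
    refine Finset.sum_congr rfl fun l _ => ?_
    rw [map_smul, hb, E.liftKaehlerDifferential_comp_D, smul_eq_mul, mul_comm]
    simp [b]

theorem derivativeIdeal_one_span {κ : Type*} (g : κ → C) (d : ι → Derivation k C C)
    (hd : ∀ E : Derivation k C C, ∃ e : ι → C, ∀ a, E a = ∑ l, e l * d l a) :
    derivativeIdeal k 1 (Ideal.span (Set.range g)) =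
      Ideal.span (Set.range g) ⊔ Ideal.span {b | ∃ l i, b = d l (g i)} := by
  apply le_antisymm
  · rw [derivativeIdeal, Ideal.span_le]
    rintro _ ⟨D, hD, a, ha, rfl⟩
    obtain ⟨E, hE⟩ := hD.exists_derivation
    obtain ⟨e, he⟩ := hd E
    rw [SetLike.mem_coe, hE, he]
    refine add_mem (Ideal.mul_mem_left _ _ (Ideal.mem_sup_left ha))
      (sum_mem fun l _ => Ideal.mul_mem_left _ _ ?_)
    induction ha using Submodule.span_induction with
    | mem _ h =>
      obtain ⟨i, rfl⟩ := h
      exact Ideal.mem_sup_right (Ideal.subset_span ⟨l, i, rfl⟩)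
    | zero => simp
    | add _ _ _ _ h h' => rw [map_add]; exact add_mem h h'
    | smul c y hy h =>
      rw [smul_eq_mul, Derivation.leibniz, smul_eq_mul, smul_eq_mul, mul_comm y]
      exact add_mem (Ideal.mul_mem_left _ _ h)
        (Ideal.mul_mem_left _ _ (Ideal.mem_sup_left hy))
  · refine sup_le (fun a ha => Ideal.subset_span ?_) (Ideal.span_le.mpr ?_)
    -- The identity is an operator of order at most one.
    · exact ⟨_, isDifferentialOperator_one_of_derivation 0 1, a, ha, by simp⟩
    · rintro _ ⟨l, i, rfl⟩
      exact Ideal.subset_span ⟨_, isDifferentialOperator_one_of_derivation (d l) 0, g i,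
        Ideal.subset_span ⟨i, rfl⟩, by simp⟩

end DerivativeIdeal

theorem card_compl_range {N n : ℕ} (hn : n ≤ N) (COL : Fin (N - n) ↪o Fin N)
    [Fintype {l // l ∉ Set.range COL}] : Fintype.card {l // l ∉ Set.range COL} = n := by
  have h := sum_eq_sum_range_add_sum_compl COL fun _ => 1
  simp only [Finset.sum_const, Finset.card_univ, Fintype.card_fin, smul_eq_mul, mul_one] at h
  omega

theorem map_generatedIdeal {k C : Type*} [Field k] {N r c m : ℕ} [CommRing C] [Algebra k C]
    {φ : MvPolynomial (Fin N) k →ₐ[k] C} {f : Fin r → MvPolynomial (Fin N) k}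
    (hf : ∀ i, φ (f i) = 0) (ROW : Fin c ↪o Fin r) (COL : Fin c ↪o Fin N)
    [Fintype {l // l ∉ Set.range COL}]
    (hh : IsUnit (φ (minorDet f ROW COL))) (g : Fin m → MvPolynomial (Fin N) k)
    (d : {l // l ∉ Set.range COL} → Derivation k C C)
    (hd : ∀ l l' : {l // l ∉ Set.range COL},
      d l (φ (MvPolynomial.X l')) = if l' = l then 1 else 0) :
    (generatedIdeal f ROW COL g).map (φ : MvPolynomial (Fin N) k →+* C) =
      Ideal.span (Set.range fun i => φ (g i)) ⊔ Ideal.span {b | ∃ l i, b = d l (φ (g i))} := by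
  have hD := fun l => algHom_jacobianDerivation hf ROW COL l (d l) (hd l)
  rw [generatedIdeal, Ideal.map_sup, Ideal.map_span, Ideal.map_span, ← Set.range_comp]
  refine congrArg₂ _ rfl (le_antisymm ?_ ?_)
  · rw [Ideal.span_le]
    rintro _ ⟨_, ⟨l, hl, i, rfl⟩, rfl⟩
    have : φ (jacobianDerivation f ROW COL l (g i)) = _ := hD ⟨l, hl⟩ (g i)
    rw [SetLike.mem_coe, RingHom.coe_coe, this]
    exact Ideal.mul_mem_left _ _ (Ideal.subset_span ⟨⟨l, hl⟩, i, rfl⟩)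
  · rw [Ideal.span_le]
    rintro _ ⟨l, i, rfl⟩
    rw [SetLike.mem_coe, ← Ideal.unit_mul_mem_iff_mem _ hh, ← hD]
    exact Ideal.subset_span ⟨_, ⟨l, l.2, i, rfl⟩, rfl⟩

end DiffGen

theorem mainTheorem6 {k : Type*} [Field k] {N r n m : ℕ} (hn : n ≤ N)
    (f : Fin r → MvPolynomial (Fin N) k)
    (hsmooth : Algebra.Smooth k (DiffGen.CoordRing f))
    (hdim : DiffGen.IsPureDimension (DiffGen.CoordRing f) n)
    (ROW : Fin (N - n) ↪o Fin r) (COL : Fin (N - n) ↪o Fin N)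
    (g : Fin m → MvPolynomial (Fin N) k)
    (I : Ideal (DiffGen.CoordRing f))
    (hI : I = Ideal.span
      (Set.range fun i => Ideal.Quotient.mk (Ideal.span (Set.range f)) (g i))) :
    (DiffGen.generatedIdeal f ROW COL g).map
        ((algebraMap (DiffGen.CoordRing f) (DiffGen.LocalizedRing f ROW COL)).comp
          (Ideal.Quotient.mk (Ideal.span (Set.range f)))) =
      DiffGen.derivativeIdeal k 1
        (I.map (algebraMap (DiffGen.CoordRing f) (DiffGen.LocalizedRing f ROW COL))) := by
  classical
  let A := DiffGen.CoordRing f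
  let C := DiffGen.LocalizedRing f ROW COL
  let h : A := Ideal.Quotient.mk (Ideal.span (Set.range f)) (DiffGen.minorDet f ROW COL)
  let φ : MvPolynomial (Fin N) k →ₐ[k] C :=
    (IsScalarTower.toAlgHom k A C).comp (Ideal.Quotient.mkₐ k (Ideal.span (Set.range f)))
  have hφ : ∀ p, φ p = algebraMap A C (Ideal.Quotient.mk _ p) := fun _ => rfl
  have hf : ∀ i, φ (f i) = 0 := fun i => by
    have hi : f i ∈ Ideal.span (Set.range f) := Ideal.subset_span ⟨i, rfl⟩
    rw [hφ, Ideal.Quotient.eq_zero_iff_mem.mpr hi, map_zero]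
  have hh : IsUnit (φ (DiffGen.minorDet f ROW COL)) :=
    IsLocalization.Away.algebraMap_isUnit (S := C) h
  have hfrac : ∀ b : C, ∃ u p, IsUnit (φ u) ∧ φ u * b = φ p := by
    intro b
    obtain ⟨⟨a, ⟨_, e, rfl⟩⟩, hb⟩ := IsLocalization.surj (Submonoid.powers h) b
    obtain ⟨p, rfl⟩ := Ideal.Quotient.mk_surjective a
    refine ⟨DiffGen.minorDet f ROW COL ^ e, p, by rw [map_pow]; exact hh.pow e, ?_⟩
    rw [mul_comm]
    exact hb
  have hspan := DiffGen.span_kaehlerDifferential_eq_top hf hh hfrac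
  have : Algebra.FiniteType k C := inferInstanceAs
    (Algebra.FiniteType k (Localization.Away h))
  have : Algebra.FormallySmooth k C :=
    have := Algebra.FormallySmooth.of_isLocalization (Rₘ := C) (Submonoid.powers h)
    Algebra.FormallySmooth.comp k A C
  have hli := DiffGen.linearIndependent_kaehlerDifferential (k := k) _ hspan (by
    intro q hq
    -- Minimal primes of `C` contract to minimal primes of `A`, where purity gives dimension `n`.
    have hp : q.comap (algebraMap A C) ∈ minimalPrimes A := by
      have h' := IsLocalization.minimalPrimes_map (Submonoid.powers h) C (⊥ : Ideal A)
      rw [Ideal.map_bot] at h'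
      exact h'.le hq
    refine ⟨A ⧸ q.comap (algebraMap A C), inferInstance, inferInstance, inferInstance,
      Ideal.quotientMapₐ q (IsScalarTower.toAlgHom k A C) le_rfl,
      Ideal.quotientMap_injective, ?_⟩
    rw [hdim _ hp, DiffGen.card_compl_range hn])
  obtain ⟨d, hd, hE⟩ := DiffGen.exists_dual_derivations _ hli hspan
  have hIC : I.map (algebraMap A C) = Ideal.span (Set.range fun i => φ (g i)) := by
    rw [hI, Ideal.map_span, ← Set.range_comp]
    rfl
  refine (DiffGen.map_generatedIdeal hf ROW COL hh g d hd).trans ?_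
  refine Eq.trans ?_ (congrArg _ hIC.symm)
  exact (DiffGen.derivativeIdeal_one_span _ d fun E => ⟨_, hE E⟩).symm
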